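/- For integers $k,m\ge 0$ and $r\ge 1$ let $$d_k(m,r)=\det\left(\binom{k+i+j}{m}\right)_{i,j=0}^{r-1}.$$ For integers $r\ge 1$ and $n,j\ge 0$ let $N(r,n,j)$ be the $r$-dimensional Narayana number, that is, the number of lattice paths $p_1p_2\cdots p_{rn}$ in $\mathbb{Z}^r$ from $(0,\dots,0)$ to $(n,\dots,n)$ whose steps are unit vectors $X_1=(1,0,\dots,0),\dots,X_r=(0,\dots,0,1)$, which stay in the region $0\le x_1\le x_2\le\cdots\le x_r$, and which have exactly $j$ ascents, where an ascent is an index $t$ such that $p_tp_{t+1}=X_aX_b$ with $a<b$. Then for all integers $r\ge 1$ and $m\ge r-1$ the following identity of formal power series over $\mathbb{Z}$ holds: $$(1-x)^{r(m-r+1)+1}\sum_{k\ge 0}d_k(m,r)\,x^k=(-1)^{\binom r2}\,x^{m-r+1}A_{m,r}(x),$$ where $$A_{m,r}(x)=\sum_{j=0}^{(r-1)(m-r)}N(r,m-r+1,j)\,x^j\quad\text{for } m\ge r,\qquad A_{r-1,r}(x)=N(r,0,0)=1.$$ -/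

import Mathlib

/-- The Hankel determinant `det (binom (k+i+j) m)`, `0 ≤ i, j ≤ r-1`. -/
def hankelDet (k m r : ℕ) : ℤ :=
  (Matrix.of fun i j : Fin r => (((k + i + j).choose m : ℕ) : ℤ)).det

/-- `P = p₁ p₂ ⋯` is a word in the steps `X₁, …, X_r` (the unit vectors of `ℤ^r`; `i : Fin r`
stands for `X_{i+1}`), read as a lattice path starting at the origin. After an initial segment
`Q` of `P` the path has reached the point with coordinates `Q.count i`. The path is required to
end at `(n, …, n)` and to stay in the region `0 ≤ x₁ ≤ x₂ ≤ ⋯ ≤ x_r`. -/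
def IsCatalanPath (r n : ℕ) (P : List (Fin r)) : Prop :=
  (∀ i, P.count i = n) ∧ ∀ Q, Q <+: P → ∀ i j, i ≤ j → Q.count i ≤ Q.count j

/-- The number of ascents: consecutive steps `p_t p_{t+1} = X_i X_j` with `i < j`. -/
def ascents {r : ℕ} (P : List (Fin r)) : ℕ :=
  (P.zip P.tail).countP fun p => p.1 < p.2

/-- There are only finitely many such paths, so that `Set.ncard` below really counts them. -/
theorem finite_isCatalanPath (r n : ℕ) : {P | IsCatalanPath r n P}.Finite := by
  refine (List.finite_length_eq (Fin r) (∑ _i : Fin r, n)).subset ?_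
  intro P hP
  have h := Multiset.sum_count_eq_card (s := Finset.univ) (m := (P : Multiset (Fin r)))
    (fun a _ => Finset.mem_univ a)
  simp only [Multiset.coe_count, Multiset.coe_card] at h
  rw [Set.mem_ofPred_eq, ← h]
  exact Finset.sum_congr rfl fun i _ => hP.1 i

/-- The `r`-dimensional Narayana number `N(r, n, j)`: the number of lattice paths from
`(0, …, 0)` to `(n, …, n)` in the region `0 ≤ x₁ ≤ ⋯ ≤ x_r` with exactly `j` ascents. -/
noncomputable def narayana (r n j : ℕ) : ℕ :=
  {P : List (Fin r) | IsCatalanPath r n P ∧ ascents P = j}.ncard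

/-- The polynomial `A_{m,r}(x) = ∑_{j=0}^{(r-1)(m-r)} N(r, m-r+1, j) x^j` for `m ≥ r ≥ 1`.
For `m = r - 1` the truncated upper limit is `0`, and the polynomial is `N(r, 0, 0) = 1`. -/
noncomputable def narayanaPoly (m r : ℕ) : Polynomial ℤ :=
  ∑ j ∈ Finset.range ((r - 1) * (m - r) + 1),
    Polynomial.C (narayana r (m + 1 - r) j : ℤ) * Polynomial.X ^ j

/-!
The rational function `X ^ asc P / (1 - X) ^ (|P| + 1)` counts, by number of bars, the ways to place
bars in the gaps and at both ends of a word `P` so that every ascent is separated by a bar. Between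
consecutive bars such a word is weakly decreasing. Hence a barred path can be built by running,
before the first bar and after each bar, once through the letters `r - 1, …, 1, 0` and appending
each of them any number of times. When the letter `i` is treated, the numbers of paths to a
point `c` obey `F i c = F (i + 1) c + F i (c - e_i)`, the last term being absent if `c - e_i` leaves
the region.

The determinants `det (binom (c_t + K) (K + j - t))`, with `K` raised by one in the rows of index at
least `i`, obey the same recurrence: it is Pascal's rule in row `i`, and the additional determinant
has a zero row or two equal rows when `c - e_i` leaves the region. They therefore count the paths
with `K` bars, and for `c = (n, …, n)` they become the Hankel determinants after a monic change of
basis and the reversal of the order of the rows, whose sign is `(-1) ^ (r choose 2)`.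
-/

section BallotRecurrence

variable {r : ℕ}

/-- The recurrence for the numbers `F i c` of lattice paths to `c` in the region `x₁ ≤ ⋯ ≤ x_r`,
i.e. through monotone points, whose final run of steps uses only indices at least `i`. Lowering the
threshold from `i + 1` to `i` adds the paths with last step `i`, which come from `c - e_i`. The
boundary values `F r c` are left free. -/
structure IsBallotRecurrence {M : Type*} [Add M] (F : ℕ → (Fin r → ℕ) → M) : Prop where
  add_single : ∀ (i : Fin r) (b : Fin r → ℕ), Monotone b → Monotone (b + Pi.single i 1) →
    F i (b + Pi.single i 1) = F (i + 1) (b + Pi.single i 1) + F i b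
  eq_succ : ∀ (i : Fin r) (c : Fin r → ℕ), Monotone c →
    (∀ b : Fin r → ℕ, Monotone b → b + Pi.single i 1 ≠ c) → F i c = F (i + 1) c

theorem IsBallotRecurrence.map {M N H : Type*} [Add M] [Add N] [FunLike H M N]
    [AddHomClass H M N] {F : ℕ → (Fin r → ℕ) → M} (hF : IsBallotRecurrence F) (f : H) :
    IsBallotRecurrence fun i c => f (F i c) where
  add_single i b hb hbi := by rw [hF.add_single i b hb hbi, map_add]
  eq_succ i c hc h := by rw [hF.eq_succ i c hc h]

theorem IsBallotRecurrence.eq_of_eq_top {M : Type*} [Add M] {F G : ℕ → (Fin r → ℕ) → M}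
    (hF : IsBallotRecurrence F) (hG : IsBallotRecurrence G)
    (top : ∀ c, Monotone c → F r c = G r c) {i : ℕ} (hi : i ≤ r) {c : Fin r → ℕ}
    (hc : Monotone c) : F i c = G i c := by
  induction hs : r - i + ∑ t, c t using Nat.strong_induction_on generalizing i c with
  | _ s ih =>
    rcases hi.eq_or_lt with hir | hi
    · exact hir ▸ top c hc
    · have raise : F (i + 1) c = G (i + 1) c := ih _ (by omega) hi hc rfl
      let j : Fin r := ⟨i, hi⟩
      by_cases h : ∃ b : Fin r → ℕ, Monotone b ∧ b + Pi.single j 1 = c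
      · obtain ⟨b, hb, rfl⟩ := h
        have sum_lt : ∑ t, b t < ∑ t, (b + Pi.single j 1 : Fin r → ℕ) t := by
          simp [Finset.sum_add_distrib]
        rw [hF.add_single j b hb hc, hG.add_single j b hb hc, raise,
          ih _ (by omega) hi.le hb rfl]
      · push Not at h
        rw [hF.eq_succ j c hc h, hG.eq_succ j c hc h, raise]

theorem exists_add_single_eq {c : Fin r → ℕ} (hc : Monotone c) {i : Fin r} (hpos : 0 < c i)
    (hlt : ∀ t < i, c t < c i) : ∃ b : Fin r → ℕ, Monotone b ∧ b + Pi.single i 1 = c := by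
  refine ⟨Function.update c i (c i - 1), fun s t hst => ?_, funext fun t => ?_⟩
  · have hst' := hc hst
    simp only [Function.update_apply]
    split_ifs with hs ht ht
    · rfl
    · rw [← hs]
      omega
    · have := hlt s (lt_of_le_of_ne (hst.trans_eq ht) hs)
      omega
    · exact hst'
  · simp only [Pi.add_apply, Function.update_apply, Pi.single_apply]
    split_ifs with ht
    · rw [ht, Nat.sub_add_cancel hpos]
    · rfl

theorem eq_zero_or_eq_pred_of_forall_add_single_ne {c : Fin r → ℕ} (hc : Monotone c) {i : Fin r}
    (h : ∀ b : Fin r → ℕ, Monotone b → b + Pi.single i 1 ≠ c) :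
    ((i : ℕ) = 0 ∧ c i = 0) ∨ ∃ t : Fin r, (t : ℕ) + 1 = i ∧ c t = c i := by
  rcases Nat.eq_zero_or_eq_succ_pred (i : ℕ) with hi | hi
  · refine Or.inl ⟨hi, Nat.eq_zero_of_not_pos fun hpos => ?_⟩
    obtain ⟨b, hb, e⟩ := exists_add_single_eq hc hpos fun t ht => by
      simp only [Fin.lt_def] at ht
      omega
    exact h b hb e
  · let p : Fin r := ⟨(i : ℕ).pred, by omega⟩
    have hpi : p ≤ i := Fin.le_def.2 (Nat.pred_le _)
    refine Or.inr ⟨p, hi.symm, (hc hpi).antisymm (not_lt.1 fun hlt => ?_)⟩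
    obtain ⟨b, hb, e⟩ := exists_add_single_eq hc (Nat.zero_lt_of_lt hlt) fun t ht =>
      (hc (Fin.le_def.2 (Nat.le_pred_of_lt ht) : t ≤ p)).trans_lt hlt
    exact h b hb e

theorem isBallotRecurrence_indicator (r : ℕ) :
    IsBallotRecurrence fun i (c : Fin r → ℕ) =>
      if ∀ t : Fin r, (t : ℕ) < i → c t = 0 then (1 : ℤ) else 0 where
  add_single i b _ _ := by
    have hi : ¬ ∀ t : Fin r, (t : ℕ) < i + 1 → (b + Pi.single i 1 : Fin r → ℕ) t = 0 := fun h => by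
      simpa using h i (Nat.lt_succ_self _)
    rw [if_neg hi, zero_add]
    refine if_congr (forall₂_congr fun t ht => ?_) rfl rfl
    simp [(show t < i from ht).ne]
  eq_succ i c hc h := by
    refine if_congr ⟨fun h0 t ht => ?_, fun h0 t ht => h0 t (by omega)⟩ rfl rfl
    rcases Nat.lt_succ_iff_lt_or_eq.1 ht with ht | ht
    · exact h0 t ht
    · obtain rfl : t = i := Fin.ext ht
      rcases eq_zero_or_eq_pred_of_forall_add_single_ne hc h with ⟨_, hc0⟩ | ⟨s, hs, e⟩
      · exact hc0
      · rw [← e]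
        exact h0 s (by omega)

end BallotRecurrence

section KrewerasMatrix

open Polynomial

variable {r : ℕ}

/-- The row `binom (x + K) (K + j - t)`, `0 ≤ j < r`, of the determinant of Kreweras. The binomial
coefficient is written as a coefficient of `X ^ t * (1 + X) ^ (x + K)` so that it vanishes for
`K + j < t`. -/
noncomputable def krewerasRow (K t x : ℕ) : Fin r → ℤ := fun j =>
  (X ^ t * (1 + X) ^ (x + K) : ℤ[X]).coeff (K + j)

/-- The difference of the rows `krewerasRow (K + 1) t x` and `krewerasRow K t x`. -/
noncomputable def krewerasDiff (K t x : ℕ) : Fin r → ℤ := fun j =>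
  (X ^ t * (1 + X) ^ (x + K) : ℤ[X]).coeff (K + 1 + j)

/-- The matrix of Kreweras for `K` bars and the end point `c`, with `K` replaced by `K + 1` in the
rows of index at least `i`. -/
noncomputable def krewerasMatrix (K i : ℕ) (c : Fin r → ℕ) : Matrix (Fin r) (Fin r) ℤ :=
  Matrix.of fun t => krewerasRow (if i ≤ t then K + 1 else K) t (c t)

theorem krewerasRow_succ (K t x : ℕ) :
    (krewerasRow (K + 1) t x : Fin r → ℤ) = krewerasRow K t x + krewerasDiff K t x := by
  funext j
  have pascal : (X ^ t * (1 + X) ^ (x + (K + 1)) : ℤ[X]) =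
      X * (X ^ t * (1 + X) ^ (x + K)) + X ^ t * (1 + X) ^ (x + K) := by ring
  simp only [krewerasRow, krewerasDiff, Pi.add_apply, pascal, coeff_add]
  rw [Nat.add_right_comm K 1, coeff_X_mul]

theorem krewerasDiff_succ_right (K t x : ℕ) :
    (krewerasDiff K t (x + 1) : Fin r → ℤ) = krewerasRow (K + 1) t x := by
  funext j
  rw [krewerasDiff, krewerasRow, Nat.add_right_comm x, Nat.add_assoc x]

theorem krewerasDiff_succ_left (K t x : ℕ) :
    (krewerasDiff K (t + 1) x : Fin r → ℤ) = krewerasRow K t x := by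
  funext j
  rw [krewerasDiff, krewerasRow, pow_succ', mul_assoc, Nat.add_right_comm K 1, coeff_X_mul]

theorem krewerasDiff_zero (K : ℕ) : (krewerasDiff K 0 0 : Fin r → ℤ) = 0 := by
  funext j
  rw [krewerasDiff, pow_zero, one_mul, coeff_one_add_X_pow,
    Nat.choose_eq_zero_of_lt (by omega), Nat.cast_zero, Pi.zero_apply]

theorem krewerasMatrix_apply_of_lt (K : ℕ) {i : ℕ} (c : Fin r → ℕ) {t : Fin r} (h : (t : ℕ) < i) :
    krewerasMatrix K i c t = krewerasRow K t (c t) := by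
  funext j
  rw [krewerasMatrix, Matrix.of_apply, if_neg h.not_ge]

theorem krewerasMatrix_eq_updateRow (K : ℕ) (i : Fin r) {b c : Fin r → ℕ}
    (h : ∀ t ≠ i, b t = c t) :
    krewerasMatrix K i b =
      (krewerasMatrix K (i + 1) c).updateRow i (krewerasRow (K + 1) i (b i)) := by
  ext t j
  rcases eq_or_ne t i with rfl | ht
  · simp [krewerasMatrix]
  · have hle : (i : ℕ) ≤ t ↔ (i : ℕ) + 1 ≤ t := by
      have := Fin.val_ne_of_ne ht
      omega
    rw [Matrix.updateRow_ne ht, krewerasMatrix, krewerasMatrix, Matrix.of_apply, Matrix.of_apply,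
      h t ht, if_congr hle rfl rfl]

theorem det_krewerasMatrix_eq_add (K : ℕ) (i : Fin r) (c : Fin r → ℕ) :
    (krewerasMatrix K i c).det = (krewerasMatrix K (i + 1) c).det +
      ((krewerasMatrix K (i + 1) c).updateRow i (krewerasDiff K i (c i))).det := by
  rw [krewerasMatrix_eq_updateRow K i fun _ _ => rfl, krewerasRow_succ, Matrix.det_updateRow_add,
    ← krewerasMatrix_apply_of_lt K c (Nat.lt_succ_self i), Matrix.updateRow_eq_self]

theorem isBallotRecurrence_det_krewerasMatrix (r K : ℕ) :
    IsBallotRecurrence fun i (c : Fin r → ℕ) => (krewerasMatrix K i c).det where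
  add_single i b _ _ := by
    have hb : ∀ t ≠ i, b t = (b + Pi.single i 1 : Fin r → ℕ) t := fun t ht => by simp [ht]
    rw [det_krewerasMatrix_eq_add, krewerasMatrix_eq_updateRow K i hb, Pi.add_apply,
      Pi.single_eq_same, krewerasDiff_succ_right]
  eq_succ i c hc h := by
    rw [det_krewerasMatrix_eq_add, add_eq_left]
    rcases eq_zero_or_eq_pred_of_forall_add_single_ne hc h with ⟨hi, hc0⟩ | ⟨t, ht, e⟩
    · refine Matrix.det_eq_zero_of_row_eq_zero i fun j => ?_
      rw [Matrix.updateRow_self, hi, hc0, krewerasDiff_zero, Pi.zero_apply]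
    · have hne : t ≠ i := by
        rintro rfl
        omega
      refine Matrix.det_zero_of_row_eq hne ?_
      rw [Matrix.updateRow_self, Matrix.updateRow_ne hne, ← ht, krewerasDiff_succ_left, ← e,
        krewerasMatrix_apply_of_lt K c (by omega)]

theorem krewerasMatrix_succ_top (K : ℕ) (c : Fin r → ℕ) :
    krewerasMatrix (K + 1) r c = krewerasMatrix K 0 c := by
  ext t j
  rw [krewerasMatrix_apply_of_lt _ _ t.2, krewerasMatrix, Matrix.of_apply, if_pos (Nat.zero_le _)]

theorem det_krewerasMatrix_zero_top (c : Fin r → ℕ) : (krewerasMatrix 0 r c).det = 1 := by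
  have entry (t j : Fin r) :
      krewerasMatrix 0 r c t j = (X ^ (t : ℕ) * (1 + X) ^ c t : ℤ[X]).coeff j := by
    rw [krewerasMatrix_apply_of_lt _ _ t.2, krewerasRow, Nat.add_zero, Nat.zero_add]
  rw [Matrix.det_of_isUpperTriangular]
  · refine Finset.prod_eq_one fun t _ => ?_
    simp [entry, coeff_X_pow_mul', coeff_one_add_X_pow]
  · intro t j (h : j < t)
    rw [entry, coeff_X_pow_mul', if_neg (Fin.lt_def.1 h).not_ge]

end KrewerasMatrix

section HankelDeterminant

open Polynomial

theorem det_of_linearMap_monic_mul_monic {R : Type*} [CommRing R] {r : ℕ} (L : R[X] →ₗ[R] R)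
    (p : Fin r → R[X]) (hdeg : ∀ i, (p i).natDegree = i) (hp : ∀ i, (p i).Monic) :
    (Matrix.of fun i j => L (p i * p j)).det =
      (Matrix.of fun i j : Fin r => L (X ^ (i + j : ℕ))).det := by
  let T : Matrix (Fin r) (Fin r) R := Matrix.of fun i j => (p j).coeff i
  have expand (i : Fin r) : p i = ∑ l : Fin r, T l i • X ^ (l : ℕ) := by
    rw [(p i).as_sum_range' r (by rw [hdeg]; exact i.2), Finset.sum_range]
    simp only [T, ← smul_X_eq_monomial, Matrix.of_apply]
  have factor : (Matrix.of fun i j => L (p i * p j)) =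
      T.transpose * (Matrix.of fun i j : Fin r => L (X ^ (i + j : ℕ))) * T := by
    ext i j
    simp only [Matrix.mul_apply, Matrix.of_apply, Matrix.transpose_apply, Finset.sum_mul]
    conv_lhs => rw [expand i, expand j, Finset.sum_mul_sum, Finset.sum_comm]
    simp only [map_sum, smul_mul_smul_comm, ← pow_add, map_smul, smul_eq_mul]
    exact Finset.sum_congr rfl fun _ _ => Finset.sum_congr rfl fun _ _ => mul_right_comm _ _ _
  rw [factor, Matrix.det_mul, Matrix.det_mul, Matrix.det_transpose,
    Matrix.det_matrixOfPolynomials p hdeg hp, one_mul, mul_one]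

theorem hankelDet_eq_det_coeff (k m r : ℕ) :
    hankelDet k m r =
      (Matrix.of fun i j : Fin r => ((1 + X) ^ k * X ^ (i + j : ℕ) : ℤ[X]).coeff m).det := by
  have h := det_of_linearMap_monic_mul_monic
    (lcoeff ℤ m ∘ₗ LinearMap.mulLeft ℤ ((1 + X : ℤ[X]) ^ k)) (fun i : Fin r => (X + 1) ^ (i : ℕ))
    (fun i => by simpa using natDegree_pow_X_add_C (R := ℤ) i 1)
    fun i => by simpa using (monic_X_add_C (1 : ℤ)).pow i
  simp only [LinearMap.comp_apply, LinearMap.mulLeft_apply, lcoeff_apply] at h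
  rw [← h, hankelDet]
  congr 2
  funext i j
  rw [← coeff_one_add_X_pow, add_comm X 1, pow_add, pow_add, mul_assoc]

theorem sign_revPerm (r : ℕ) :
    Equiv.Perm.sign (Fin.revPerm : Equiv.Perm (Fin r)) = (-1) ^ r.choose 2 := by
  have row (j : Fin r) : ∏ i ∈ Finset.Iio j,
      (if (Fin.revPerm i : Fin r) < Fin.revPerm j then (1 : ℤˣ) else -1) = (-1) ^ (j : ℕ) := by
    rw [Finset.prod_congr rfl (g := fun _ => (-1 : ℤˣ)) fun i hi =>
      if_neg (by simpa using (Finset.mem_Iio.1 hi).le), Finset.prod_const, Fin.card_Iio]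
  rw [Equiv.Perm.sign_eq_prod_prod_Iio, Finset.prod_congr rfl fun j _ => row j,
    Finset.prod_pow_eq_pow_sum, Fin.sum_univ_eq_sum_range (fun i => i), Finset.sum_range_id,
    Nat.choose_two_right]

theorem coeff_X_pow_mul_one_add_X_pow_symm {R : Type*} [CommSemiring R] {a b s t N : ℕ}
    (h : a + b = N + s + t) :
    (X ^ s * (1 + X) ^ N : R[X]).coeff a = (X ^ t * (1 + X) ^ N : R[X]).coeff b := by
  simp only [coeff_X_pow_mul', coeff_one_add_X_pow]
  split_ifs with hs ht ht
  · rw [← Nat.choose_symm (by omega), show N - (a - s) = b - t by omega]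
  · rw [Nat.choose_eq_zero_of_lt (by omega), Nat.cast_zero]
  · rw [Nat.choose_eq_zero_of_lt (by omega), Nat.cast_zero]
  · rfl

theorem hankelDet_eq_det_krewerasMatrix {m n r : ℕ} (hm : m + 1 = n + r) (K : ℕ) :
    hankelDet (n + K) m r =
      (-1) ^ r.choose 2 * (krewerasMatrix K r fun _ : Fin r => n).det := by
  have reverse : (Matrix.of fun i j : Fin r =>
      ((1 + X) ^ (n + K) * X ^ (i + j : ℕ) : ℤ[X]).coeff m) =
      (krewerasMatrix K r fun _ : Fin r => n).submatrix Fin.revPerm id := by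
    ext i j
    rw [Matrix.submatrix_apply, krewerasMatrix_apply_of_lt _ _ (Fin.is_lt _), krewerasRow,
      Matrix.of_apply, mul_comm]
    refine coeff_X_pow_mul_one_add_X_pow_symm ?_
    simp only [Fin.revPerm_apply, Fin.val_rev, id]
    omega
  rw [hankelDet_eq_det_coeff, reverse, Matrix.det_permute, sign_revPerm]
  simp

theorem hankelDet_eq_zero {k m r : ℕ} (hr : 1 ≤ r) (hk : k + r ≤ m) : hankelDet k m r = 0 := by
  refine Matrix.det_eq_zero_of_row_eq_zero ⟨0, hr⟩ fun j => ?_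
  rw [Matrix.of_apply, Nat.choose_eq_zero_of_lt (by simp only; omega), Nat.cast_zero]

end HankelDeterminant

section Ascents

theorem ascents_cons_cons {r : ℕ} (a b : Fin r) (P : List (Fin r)) :
    ascents (a :: b :: P) = ascents (b :: P) + if a < b then 1 else 0 := by
  simp [ascents, List.countP_cons]

theorem ascents_append_singleton {r : ℕ} (P : List (Fin r)) (l : Fin r) :
    ascents (P ++ [l]) = ascents P + if ∀ a ∈ P.getLast?, l ≤ a then 0 else 1 := by
  induction P with
  | nil => simp [ascents]
  | cons a P ih =>
    cases P with
    | nil =>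
      rw [List.singleton_append, ascents_cons_cons]
      simp only [List.getLast?_singleton, Option.mem_some_iff, forall_eq', ← not_le, ite_not]
      rfl
    | cons b P =>
      rw [List.cons_append, List.cons_append, ascents_cons_cons, ascents_cons_cons,
        ← List.cons_append, ih, List.getLast?_cons_cons, Nat.add_right_comm]

end Ascents

section BallotPaths

/-- Lattice paths from the origin to `c` inside the region `x₁ ≤ ⋯ ≤ x_r`, encoded as in
`IsCatalanPath`. -/
def IsBallotPath {r : ℕ} (c : Fin r → ℕ) (P : List (Fin r)) : Prop :=
  (∀ i, P.count i = c i) ∧ ∀ Q, Q <+: P → Monotone fun i => Q.count i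

variable {r : ℕ} {b c : Fin r → ℕ} {P : List (Fin r)}

theorem IsBallotPath.monotone (h : IsBallotPath c P) : Monotone c :=
  funext h.1 ▸ h.2 P List.prefix_rfl

theorem IsBallotPath.length_eq (h : IsBallotPath c P) : P.length = ∑ i, c i := by
  have card := Multiset.sum_count_eq_card (s := Finset.univ) (m := (P : Multiset (Fin r)))
    fun a _ => Finset.mem_univ a
  simpa only [Multiset.coe_count, Multiset.coe_card, h.1, eq_comm] using card

theorem finite_isBallotPath (c : Fin r → ℕ) : {P | IsBallotPath c P}.Finite :=
  (List.finite_length_eq (Fin r) (∑ i, c i)).subset fun _ hP => hP.length_eq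

/-- The finite set of the lattice paths from the origin to `c` inside the region
`x₁ ≤ ⋯ ≤ x_r`. -/
noncomputable def ballotPaths (c : Fin r → ℕ) : Finset (List (Fin r)) :=
  (finite_isBallotPath c).toFinset

theorem mem_ballotPaths : P ∈ ballotPaths c ↔ IsBallotPath c P := by
  simp [ballotPaths]

theorem count_append_singleton_eq_iff {i : Fin r} :
    (∀ j, (P ++ [i]).count j = (b + Pi.single i 1 : Fin r → ℕ) j) ↔ ∀ j, P.count j = b j := by
  refine forall_congr' fun j => ?_
  rcases eq_or_ne j i with rfl | h
  · simp
  · simp [h, h.symm]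

theorem isBallotPath_append_singleton {i : Fin r} (hb : Monotone (b + Pi.single i 1)) :
    IsBallotPath (b + Pi.single i 1) (P ++ [i]) ↔ IsBallotPath b P := by
  refine (and_congr_left' count_append_singleton_eq_iff).trans (and_congr_right fun hcount => ?_)
  have hP : Monotone fun j => (P ++ [i]).count j := by
    rwa [funext (count_append_singleton_eq_iff.2 hcount)]
  refine ⟨fun h Q hQ => h Q (hQ.trans (List.prefix_append _ _)), fun h Q hQ => ?_⟩
  rcases List.prefix_concat_iff.1 hQ with rfl | hQ
  · exact hP
  · exact h Q hQ

theorem IsBallotPath.exists_add_single_eq {i : Fin r} (h : IsBallotPath c (P ++ [i])) :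
    ∃ b : Fin r → ℕ, Monotone b ∧ b + Pi.single i 1 = c := by
  refine ⟨fun j => P.count j, h.2 P (List.prefix_append _ _), funext fun j => ?_⟩
  rw [← h.1 j]
  exact (count_append_singleton_eq_iff.2 (fun _ => rfl) j).symm

theorem ascents_le_sum_count_sub_one {s : ℕ} {P : List (Fin (s + 1))}
    (h : ∀ Q, Q <+: P → Monotone fun i => Q.count i) :
    ascents P ≤ ∑ l : Fin s, (P.count l.succ - 1) := by
  induction P using List.reverseRecOn with
  | nil => simp [ascents]
  | append_singleton P l ih =>
    have ih := ih fun Q hQ => h Q (hQ.trans (List.prefix_append _ _))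
    have count_le (a : Fin s) : P.count a.succ - 1 ≤ (P ++ [l]).count a.succ - 1 :=
      Nat.sub_le_sub_right ((List.sublist_append_left P [l]).count_le _) 1
    rw [ascents_append_singleton]
    split_ifs with hl
    · exact ih.trans (Finset.sum_le_sum fun a _ => count_le a)
    · push Not at hl
      obtain ⟨a, ha, hal⟩ := hl
      obtain ⟨l, rfl⟩ := Fin.exists_succ_eq.2 (Fin.ne_zero_of_lt hal)
      -- An ascent into `l` is preceded by a smaller letter, hence by a step `l`.
      have count_pos : 0 < P.count l.succ :=
        (List.count_pos_iff.2 (List.mem_of_getLast? ha)).trans_le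
          (h P (List.prefix_append _ _) hal.le)
      have count_lt : P.count l.succ - 1 < (P ++ [l.succ]).count l.succ - 1 := by
        rw [List.count_append, List.count_singleton_self]
        omega
      exact Nat.succ_le_of_lt (ih.trans_lt
        (Finset.sum_lt_sum (fun a _ => count_le a) ⟨l, Finset.mem_univ l, count_lt⟩))

end BallotPaths

section BarredPaths

open PowerSeries

variable {r : ℕ}

/-- The generating function, by number of bars, of the placements of bars in the gaps and at both
ends of the word `P` such that every ascent is separated by at least one bar. -/
noncomputable def barredWeight (P : List (Fin r)) : ℤ⟦X⟧ :=
  X ^ ascents P * mk 1 ^ (P.length + 1)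

/-- As `barredWeight`, where the letters after the last bar are required to be at least `i`. These
letters decrease weakly, so that only the last letter of `P` matters: if it is smaller than `i`, at
least one bar has to follow it. -/
noncomputable def barredWeightFrom (i : ℕ) (P : List (Fin r)) : ℤ⟦X⟧ :=
  (if ∀ a ∈ P.getLast?, i ≤ (a : ℕ) then 1 else X) * barredWeight P

theorem barredWeightFrom_zero (P : List (Fin r)) : barredWeightFrom 0 P = barredWeight P := by
  simp [barredWeightFrom]

theorem one_sub_X_mul_barredWeight_append_singleton (P : List (Fin r)) (l : Fin r) :
    (1 - X) * barredWeight (P ++ [l]) = barredWeightFrom l P := by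
  have cancel : (1 - X) * barredWeight (P ++ [l]) =
      X ^ ascents (P ++ [l]) * mk 1 ^ (P.length + 1) := by
    rw [barredWeight, List.length_append, List.length_singleton]
    linear_combination (X ^ ascents (P ++ [l]) * mk 1 ^ (P.length + 1)) *
      mk_one_mul_one_sub_eq_one ℤ
  rw [cancel, ascents_append_singleton, barredWeightFrom, barredWeight, pow_add, mul_comm (X ^ _),
    mul_assoc]
  simp only [Fin.val_fin_le, apply_ite (X ^ · : ℕ → ℤ⟦X⟧), pow_zero, pow_one]

theorem barredWeightFrom_eq_add (i : Fin r) (P : List (Fin r)) :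
    barredWeightFrom i P = barredWeightFrom (i + 1) P +
      if P.getLast? = some i then (1 - X) * barredWeight P else 0 := by
  unfold barredWeightFrom
  cases P.getLast? with
  | none => simp
  | some a =>
    simp only [Option.mem_some_iff, forall_eq', Option.some.injEq]
    rcases lt_trichotomy a i with h | rfl | h
    · have := Fin.lt_def.1 h
      rw [if_neg (by omega), if_neg (by omega), if_neg h.ne, add_zero]
    · rw [if_pos le_rfl, if_neg (by omega), if_pos rfl]
      ring
    · have := Fin.lt_def.1 h
      rw [if_pos (by omega), if_pos (by omega), if_neg h.ne', add_zero]

theorem barredWeightFrom_top (P : List (Fin r)) :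
    barredWeightFrom r P = X * barredWeight P + if P = [] then 1 else 0 := by
  unfold barredWeightFrom
  rcases List.eq_nil_or_concat P with rfl | ⟨Q, l, rfl⟩
  · suffices (mk 1 : ℤ⟦X⟧) = X * mk 1 + 1 by simpa [barredWeight, ascents] using this
    linear_combination mk_one_mul_one_sub_eq_one ℤ
  · simp

/-- The generating function, by number of bars, of the barred lattice paths to `c` whose letters
after the last bar are at least `i`. -/
noncomputable def barredSeries (i : ℕ) (c : Fin r → ℕ) : ℤ⟦X⟧ :=
  ∑ P ∈ ballotPaths c, barredWeightFrom i P

theorem barredSeries_eq_add (i : Fin r) (c : Fin r → ℕ) :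
    barredSeries i c = barredSeries (i + 1) c +
      ∑ P ∈ ballotPaths c with P.getLast? = some i, (1 - X) * barredWeight P := by
  rw [barredSeries, barredSeries, Finset.sum_filter, ← Finset.sum_add_distrib]
  exact Finset.sum_congr rfl fun P _ => barredWeightFrom_eq_add i P

theorem ballotPaths_filter_getLast?_eq_image {b : Fin r → ℕ} {i : Fin r}
    (hb : Monotone (b + Pi.single i 1)) :
    {P ∈ ballotPaths (b + Pi.single i 1) | P.getLast? = some i} =
      (ballotPaths b).image (· ++ [i]) := by
  ext P
  simp only [Finset.mem_filter, Finset.mem_image, mem_ballotPaths, List.getLast?_eq_some_iff]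
  constructor
  · rintro ⟨hP, Q, rfl⟩
    exact ⟨Q, (isBallotPath_append_singleton hb).1 hP, rfl⟩
  · rintro ⟨Q, hQ, rfl⟩
    exact ⟨(isBallotPath_append_singleton hb).2 hQ, Q, rfl⟩

theorem isBallotRecurrence_barredSeries (r : ℕ) :
    IsBallotRecurrence (barredSeries : ℕ → (Fin r → ℕ) → ℤ⟦X⟧) where
  add_single i b _ hbi := by
    rw [barredSeries_eq_add, ballotPaths_filter_getLast?_eq_image hbi,
      Finset.sum_image fun _ _ _ _ h => List.append_cancel_right h]
    simp only [one_sub_X_mul_barredWeight_append_singleton, barredSeries]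
  eq_succ i c _ h := by
    rw [barredSeries_eq_add, add_eq_left, Finset.filter_false_of_mem, Finset.sum_empty]
    intro P hP hlast
    obtain ⟨Q, rfl⟩ := List.getLast?_eq_some_iff.1 hlast
    obtain ⟨b, hb, e⟩ := (mem_ballotPaths.1 hP).exists_add_single_eq
    exact h b hb e

theorem barredSeries_top (c : Fin r → ℕ) :
    barredSeries r c = X * barredSeries 0 c + if ∀ t, c t = 0 then 1 else 0 := by
  have nil_mem : [] ∈ ballotPaths c ↔ ∀ t, c t = 0 := by
    simp [mem_ballotPaths, IsBallotPath, monotone_const, eq_comm (a := 0)]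
  simp only [barredSeries, barredWeightFrom_top, barredWeightFrom_zero, Finset.sum_add_distrib,
    Finset.mul_sum, Finset.sum_ite_eq', nil_mem]

theorem coeff_zero_barredSeries {c : Fin r → ℕ} (hc : Monotone c) :
    coeff 0 (barredSeries 0 c) = 1 := by
  have h := ((isBallotRecurrence_barredSeries r).map (coeff (R := ℤ) 0)).eq_of_eq_top
    (isBallotRecurrence_indicator r) (fun c _ => ?_) (Nat.zero_le r) hc
  · simpa using h
  · rw [barredSeries_top, map_add, coeff_zero_X_mul, zero_add, apply_ite (coeff 0)]
    simp

theorem coeff_succ_barredSeries_top (K : ℕ) (c : Fin r → ℕ) :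
    coeff (K + 1) (barredSeries r c) = coeff K (barredSeries 0 c) := by
  rw [barredSeries_top, map_add, coeff_succ_X_mul, apply_ite (coeff (K + 1))]
  simp [coeff_one]

theorem coeff_barredSeries (K : ℕ) {c : Fin r → ℕ} (hc : Monotone c) :
    coeff K (barredSeries 0 c) = (krewerasMatrix K r c).det := by
  induction K generalizing c with
  | zero => rw [det_krewerasMatrix_zero_top, coeff_zero_barredSeries hc]
  | succ K ih =>
    rw [krewerasMatrix_succ_top]
    refine ((isBallotRecurrence_barredSeries r).map (coeff (K + 1))).eq_of_eq_top
      (isBallotRecurrence_det_krewerasMatrix r K) (fun c hc => ?_) (Nat.zero_le r) hc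
    rw [coeff_succ_barredSeries_top, ih hc]

theorem one_sub_X_pow_mul_barredSeries (c : Fin r → ℕ) :
    (1 - X) ^ (∑ i, c i + 1) * barredSeries 0 c = ∑ P ∈ ballotPaths c, X ^ ascents P := by
  rw [barredSeries, Finset.mul_sum]
  refine Finset.sum_congr rfl fun P hP => ?_
  rw [barredWeightFrom_zero, barredWeight, (mem_ballotPaths.1 hP).length_eq, mul_left_comm,
    ← mul_pow, mul_comm (1 - X), mk_one_mul_one_sub_eq_one, one_pow, mul_one]

theorem mk_hankelDet_eq_mul_barredSeries {m n r : ℕ} (hr : 1 ≤ r) (hm : m + 1 = n + r) :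
    mk (fun k => hankelDet k m r) =
      (-1) ^ r.choose 2 * X ^ n * barredSeries 0 fun _ : Fin r => n := by
  ext k
  have sign : ((-1) ^ r.choose 2 : ℤ⟦X⟧) = C ((-1) ^ r.choose 2 : ℤ) := by simp
  rw [coeff_mk, sign, mul_assoc, coeff_C_mul, coeff_X_pow_mul']
  split_ifs with h
  · obtain ⟨K, rfl⟩ := Nat.exists_eq_add_of_le h
    rw [hankelDet_eq_det_krewerasMatrix hm, Nat.add_sub_cancel_left,
      coeff_barredSeries K monotone_const]
  · rw [hankelDet_eq_zero hr (by omega), mul_zero]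

end BarredPaths

section Narayana

open PowerSeries

theorem ascents_mem_range {n r : ℕ} (hr : 1 ≤ r) {P : List (Fin r)}
    (hP : P ∈ ballotPaths fun _ => n) : ascents P ∈ Finset.range ((r - 1) * (n - 1) + 1) := by
  obtain ⟨s, rfl⟩ := Nat.exists_eq_add_of_le' hr
  obtain ⟨hcount, hmono⟩ := mem_ballotPaths.1 hP
  simpa [hcount, Nat.lt_succ_iff] using ascents_le_sum_count_sub_one hmono

theorem card_ballotPaths_filter_ascents_eq_narayana (r n j : ℕ) :
    ({P ∈ ballotPaths fun _ : Fin r => n | ascents P = j} : Finset _).card = narayana r n j := by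
  rw [narayana, ← Set.ncard_coe_finset]
  congr 1
  ext P
  simp [mem_ballotPaths, IsBallotPath, IsCatalanPath, Monotone]

theorem sum_X_pow_ascents_eq_narayanaPoly {m r : ℕ} (hr : 1 ≤ r) :
    ∑ P ∈ ballotPaths (fun _ : Fin r => m + 1 - r), (X : ℤ⟦X⟧) ^ ascents P = narayanaPoly m r := by
  have hmaps : ∀ P ∈ ballotPaths (fun _ : Fin r => m + 1 - r),
      ascents P ∈ Finset.range ((r - 1) * (m - r) + 1) := fun P hP => by
    rw [show m - r = m + 1 - r - 1 by omega]
    exact ascents_mem_range hr hP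
  rw [← Finset.sum_fiberwise_of_maps_to hmaps, narayanaPoly,
    ← Polynomial.coeToPowerSeries.ringHom_apply, map_sum]
  refine Finset.sum_congr rfl fun j _ => ?_
  rw [Finset.sum_congr rfl fun P hP => by rw [(Finset.mem_filter.1 hP).2], Finset.sum_const,
    card_ballotPaths_filter_ascents_eq_narayana, Polynomial.coeToPowerSeries.ringHom_apply,
    Polynomial.coe_mul, Polynomial.coe_C, Polynomial.coe_pow, Polynomial.coe_X, nsmul_eq_mul,
    map_natCast]

end Narayana

theorem theorem2 (m r : ℕ) (hr : 1 ≤ r) (hm : r ≤ m + 1) :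
    (1 - PowerSeries.X) ^ (r * (m + 1 - r) + 1) *
        PowerSeries.mk (fun k => hankelDet k m r) =
      (-1) ^ (r.choose 2) * PowerSeries.X ^ (m + 1 - r) *
        (narayanaPoly m r : PowerSeries ℤ) := by
  have numerator := one_sub_X_pow_mul_barredSeries fun _ : Fin r => m + 1 - r
  rw [Fin.sum_const, smul_eq_mul, sum_X_pow_ascents_eq_narayanaPoly hr] at numerator
  rw [mk_hankelDet_eq_mul_barredSeries hr (Nat.sub_add_cancel hm).symm, mul_left_comm, numerator]
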